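/- For a finite sequence $\mathbf{s}=(s_1,\dots,s_r)$ of positive integers with $s_1>1$ let $$\zeta^\star(s_1,\dots,s_r)=\sum_{k_1\ge\cdots\ge k_r\ge 1}\frac{1}{k_1^{s_1}\cdots k_r^{s_r}}$$ be the multiple zeta star value, a convergent series over integer tuples, with $\zeta^\star(\emptyset)=1$ for the empty sequence ($r=0$). Let $\{3,1\}^d$ denote the sequence consisting of $d$ successive repetitions of $3,1$ (empty for $d=0$), and let $B_n$ denote the Bernoulli numbers, $\frac{t}{e^t-1}=\sum_{n\ge 0}B_n\frac{t^n}{n!}$. Then for every integer $d\ge 0$, $$\zeta^\star(\{3,1\}^d)=4\pi^{4d}\sum_{k=0}^{2d}(-1)^k\,(4^{k+1}-1)\,\frac{B_{2k+2}}{(2k+2)!}\,\frac{B_{4d-2k}}{(4d-2k)!},$$ $$\zeta^\star(\{3,1\}^d,2)=4\pi^{4d+2}\sum_{k=0}^{2d+1}(-1)^k\,(4^{k+1}-1)\,\frac{B_{2k+2}}{(2k+2)!}\,\frac{B_{4d+2-2k}}{(4d+2-2k)!}.$$ -/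

import Mathlib

/-- The weakly decreasing `r`-tuples `k₁ ≥ ⋯ ≥ k_r ≥ 1` of positive integers. -/
def StarIndex (r : ℕ) : Type :=
  {k : Fin r → ℕ // Antitone k ∧ ∀ i, 1 ≤ k i}

/-- The summand `1 / (k₁ ^ s₁ ⋯ k_r ^ s_r)` of the multiple zeta star series of `s`. -/
noncomputable def zetaStarTerm (s : List ℕ) (k : StarIndex s.length) : ℝ :=
  1 / ∏ i : Fin s.length, (k.1 i : ℝ) ^ s.get i

/-- The multiple zeta star value of the multi-index `s = (s₁, …, s_r)`; for the empty multi-index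
there is exactly one (empty) tuple, and the value is `1`. -/
noncomputable def zetaStar (s : List ℕ) : ℝ :=
  ∑' k : StarIndex s.length, zetaStarTerm s k

/-- The multi-index `{a₁, …, a_m}^d`: `d` successive repetitions of a finite sequence. -/
def repeatIndex (a : List ℕ) (d : ℕ) : List ℕ :=
  (List.replicate d a).flatten

open Filter Topology Finset

/-! Write a_l = (-1)^l / l^2 and let r_m(L) be the coefficient of y^m in the product of (1 + a_l y)
/ (1 - a_l y) over 1 ≤ l ≤ L. Let R(n, l) = (n choose l) / (n + l choose l). The heart of the proof
is a finite identity, `truncStar_threeOneIndex`: up to the sign (-1)^m, the truncated star sum of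
{3,1}^d (m = 2d) or of ({3,1}^d, 2) (m = 2d + 1) is r_m(0) plus the sum over l of (r_m(l) -
r_m(l-1)) R(n, l). It is proved by differencing in n, which multiplies the l-th coefficient by l^2 /
n^2, and by telescoping in l.

As n → ∞, R(n, l) → 1 and the transform collapses to lim r_m(L) (`tendsto_ratioTransform`). Hence
the generating function of the star values, in powers of z^2, is the infinite product at y = -z^2.
Euler's sine product evaluates it (`tsum_ratioLimit_mul_sin`), giving tan(πz/2) coth(πz/2).

Both factors are Bernoulli series: t/(e^t - 1) plus its reflection is t coth(t/2), and tan x = cot x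
- 2 cot 2x. Comparing coefficients of their product gives the two formulas at once
(`ratioLimit_eq`). -/

/-! ### Star series as limits of truncated sums. -/

/-- The truncated multiple zeta star sum over `n ≥ k₁ ≥ ⋯ ≥ k_r ≥ 1`. -/
noncomputable def truncStar : List ℕ → ℕ → ℝ
  | [], _ => 1
  | a :: s, n => ∑ j ∈ range n, 1 / ((j + 1 : ℕ) : ℝ) ^ a * truncStar s (j + 1)

theorem truncStar_nonneg (s : List ℕ) (n : ℕ) : 0 ≤ truncStar s n := by
  induction s generalizing n with
  | nil => simp [truncStar]
  | cons a s ih => exact sum_nonneg fun j _ => mul_nonneg (by positivity) (ih _)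

theorem truncStar_mono (s : List ℕ) : Monotone (truncStar s) := by
  cases s with
  | nil => exact fun _ _ _ => le_rfl
  | cons a s =>
    intro m n h
    exact sum_le_sum_of_subset_of_nonneg (range_mono h) fun j _ _ =>
      mul_nonneg (by positivity) (truncStar_nonneg _ _)

theorem zetaStarTerm_nonneg (s : List ℕ) (k : StarIndex s.length) : 0 ≤ zetaStarTerm s k := by
  unfold zetaStarTerm
  positivity

/-- Splitting off the first (largest) entry of a weakly decreasing tuple. -/
def StarIndex.split {r : ℕ} (k : StarIndex (r + 1)) : ℕ × StarIndex r :=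
  (k.1 0 - 1, ⟨fun i => k.1 i.succ,
    fun _ _ h => k.2.1 (Fin.succ_le_succ_iff.2 h), fun i => k.2.2 i.succ⟩)

theorem StarIndex.split_injective {r : ℕ} : Function.Injective (StarIndex.split (r := r)) := by
  intro k k' h
  have h0 : k.1 0 - 1 = k'.1 0 - 1 := congrArg Prod.fst h
  have hs : (fun i : Fin r => k.1 i.succ) = fun i => k'.1 i.succ :=
    congrArg (fun p : ℕ × StarIndex r => p.2.1) h
  have h1 := k.2.2 0
  have h2 := k'.2.2 0
  apply Subtype.ext
  funext i
  refine Fin.cases ?_ (fun i => congrFun hs i) i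
  omega

theorem StarIndex.mem_range_split {r : ℕ} (j : ℕ) (k : StarIndex r) (h : ∀ i, k.1 i ≤ j + 1) :
    (j, k) ∈ Set.range (StarIndex.split (r := r)) := by
  refine ⟨⟨Fin.cons (j + 1) k.1, ?_, ?_⟩, ?_⟩
  · intro a b hab
    induction b using Fin.cases with
    | zero =>
      have : a = 0 := le_antisymm hab (Fin.zero_le a)
      subst this
      exact le_rfl
    | succ b =>
      induction a using Fin.cases with
      | zero => simpa using h b
      | succ a => simpa using k.2.1 (Fin.succ_le_succ_iff.1 hab)
  · intro i
    induction i using Fin.cases with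
    | zero => simp
    | succ i => simpa using k.2.2 i
  · apply Prod.ext
    · simp [StarIndex.split]
    · apply Subtype.ext
      funext i
      simp [StarIndex.split]

-- Peeling off the largest entry matches the recursion of `truncStar`. Working in `ENNReal` permits
-- the interchange of sums before summability is known.
open Classical in
theorem tsum_zetaStarTerm_le_eq (s : List ℕ) (n : ℕ) :
    ∑' k : StarIndex s.length,
      (if ∀ i, k.1 i ≤ n then ENNReal.ofReal (zetaStarTerm s k) else 0) =
      ENNReal.ofReal (truncStar s n) := by
  induction s generalizing n with
  | nil =>
    have : Unique (StarIndex ([] : List ℕ).length) :=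
      ⟨⟨⟨fun i => i.elim0, fun i => i.elim0, fun i => i.elim0⟩⟩,
        fun k => Subtype.ext (funext fun i => i.elim0)⟩
    rw [tsum_eq_single default (fun k hk => absurd (Subsingleton.elim k _) hk)]
    rw [if_pos (fun i => i.elim0)]
    simp [zetaStarTerm, truncStar]
  | cons a s ih =>
    set g : ℕ × StarIndex s.length → ENNReal := fun p =>
      if p.1 < n then ENNReal.ofReal (1 / ((p.1 + 1 : ℕ) : ℝ) ^ a) *
        (if ∀ i, p.2.1 i ≤ p.1 + 1 then ENNReal.ofReal (zetaStarTerm s p.2) else 0) else 0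
      with hg
    have hcomp : ∀ k : StarIndex (s.length + 1),
        (if ∀ i, k.1 i ≤ n then ENNReal.ofReal (zetaStarTerm (a :: s) k) else 0) =
          g (StarIndex.split k) := by
      intro k
      have h1 := k.2.2 0
      have hk0 : k.1 0 - 1 + 1 = k.1 0 := by omega
      have hle : ∀ i : Fin s.length, k.1 i.succ ≤ k.1 0 := fun i => k.2.1 (Fin.zero_le _)
      have hterm : zetaStarTerm (a :: s) k =
          1 / ((k.1 0 : ℕ) : ℝ) ^ a * zetaStarTerm s (StarIndex.split k).2 := by
        have := Fin.prod_univ_succ (fun i : Fin (s.length + 1) =>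
          (k.1 i : ℝ) ^ (a :: s).get i)
        unfold zetaStarTerm
        rw [one_div_mul_one_div]
        exact congrArg (fun t : ℝ => 1 / t) this
      have hiff : (∀ i, k.1 i ≤ n) ↔ k.1 0 - 1 < n := by
        constructor
        · intro h
          have := h 0
          omega
        · intro h i
          have := k.2.1 (Fin.zero_le i)
          omega
      simp only [hg]
      by_cases hc : k.1 0 - 1 < n
      · rw [if_pos (hiff.2 hc), if_pos (show (StarIndex.split k).1 < n from hc), if_pos, hterm,
          ENNReal.ofReal_mul (by positivity)]
        · simp only [StarIndex.split, hk0]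
        · intro i
          simpa only [StarIndex.split, hk0] using hle i
      · rw [if_neg (fun h => hc (hiff.1 h)), if_neg (show ¬ (StarIndex.split k).1 < n from hc)]
    have hsupp : Function.support g ⊆ Set.range (StarIndex.split (r := s.length)) := by
      rintro ⟨j, k⟩ hjk
      apply StarIndex.mem_range_split
      by_contra hcon
      apply hjk
      simp only [hg]
      rw [if_neg hcon]
      simp
    calc _ = ∑' k : StarIndex (s.length + 1), g (StarIndex.split k) := tsum_congr hcomp
      _ = ∑' p, g p := StarIndex.split_injective.tsum_eq hsupp
      _ = ∑' (j : ℕ) (k : StarIndex s.length), g (j, k) := ENNReal.tsum_prod'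
      _ = ∑' j : ℕ, if j < n then ENNReal.ofReal (1 / ((j + 1 : ℕ) : ℝ) ^ a) *
            ENNReal.ofReal (truncStar s (j + 1)) else 0 := by
          refine tsum_congr fun j => ?_
          simp only [hg]
          split_ifs with hj
          · rw [ENNReal.tsum_mul_left, ih]
          · simp
      _ = ∑ j ∈ range n, ENNReal.ofReal (1 / ((j + 1 : ℕ) : ℝ) ^ a *
            truncStar s (j + 1)) := by
          rw [tsum_eq_sum (s := range n) (fun j hj => if_neg (by simpa using hj))]
          refine sum_congr rfl fun j hj => ?_
          rw [if_pos (by simpa using hj), ENNReal.ofReal_mul (by positivity)]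
      _ = _ := by
          rw [truncStar, ENNReal.ofReal_sum_of_nonneg]
          exact fun j _ => mul_nonneg (by positivity) (truncStar_nonneg _ _)

/-- The terms are nonnegative and every finite set of tuples lies below some truncation, so a limit
of the truncated sums yields summability as well as the value. -/
theorem hasSum_zetaStarTerm {s : List ℕ} {L : ℝ}
    (h : Tendsto (truncStar s) atTop (𝓝 L)) : HasSum (zetaStarTerm s) L := by
  classical
  have hL : ∀ n, truncStar s n ≤ L := (truncStar_mono s).ge_of_tendsto h
  have hL0 : 0 ≤ L := (truncStar_nonneg s 0).trans (hL 0)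
  have hupper : ∑' k, ENNReal.ofReal (zetaStarTerm s k) ≤ ENNReal.ofReal L := by
    rw [ENNReal.tsum_eq_iSup_sum]
    refine iSup_le fun t => ?_
    set n := t.sup fun k => univ.sup k.1 with hn
    have hb : ∀ k ∈ t, ∀ i, k.1 i ≤ n := fun k hk i =>
      (le_sup (f := k.1) (mem_univ i)).trans (le_sup (f := fun k : StarIndex s.length =>
        univ.sup k.1) hk)
    calc ∑ k ∈ t, ENNReal.ofReal (zetaStarTerm s k)
        = ∑ k ∈ t, (if ∀ i, k.1 i ≤ n then ENNReal.ofReal (zetaStarTerm s k) else 0) :=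
          sum_congr rfl fun k hk => (if_pos (hb k hk)).symm
      _ ≤ _ := ENNReal.sum_le_tsum t
      _ = _ := tsum_zetaStarTerm_le_eq s n
      _ ≤ _ := ENNReal.ofReal_le_ofReal (hL n)
  have hlower : ENNReal.ofReal L ≤ ∑' k, ENNReal.ofReal (zetaStarTerm s k) := by
    refine le_of_tendsto ((ENNReal.continuous_ofReal.tendsto L).comp h)
      (Eventually.of_forall fun n => ?_)
    rw [Function.comp_apply, ← tsum_zetaStarTerm_le_eq s n]
    refine ENNReal.tsum_le_tsum fun k => ?_
    split_ifs
    · exact le_rfl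
    · exact zero_le
  have heq := le_antisymm hupper hlower
  have hs : Summable (zetaStarTerm s) := by
    have := ENNReal.summable_toReal (heq.trans_ne ENNReal.ofReal_ne_top)
    simpa only [ENNReal.toReal_ofReal (zetaStarTerm_nonneg s _)] using this
  have := ENNReal.ofReal_tsum_of_nonneg (zetaStarTerm_nonneg s) hs
  rw [heq] at this
  have h2 := (ENNReal.ofReal_eq_ofReal_iff (tsum_nonneg (zetaStarTerm_nonneg s)) hL0).1 this
  rw [← h2]
  exact hs.hasSum

/-! ### Binomial ratios: differences in n and telescoping in l. -/

/-- The ratio `(n choose l) / (n + l choose l)`. -/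
noncomputable def binomRatio (n l : ℕ) : ℝ :=
  ∏ i ∈ range l, ((n : ℝ) - i) / (n + i + 1)

theorem binomRatio_zero (n : ℕ) : binomRatio n 0 = 1 := by simp [binomRatio]

theorem binomRatio_succ (n l : ℕ) :
    ((n : ℝ) + l + 1) * binomRatio n (l + 1) = (n - l) * binomRatio n l := by
  rw [binomRatio, prod_range_succ, ← binomRatio]
  field_simp

theorem binomRatio_eq_zero {n l : ℕ} (h : n < l) : binomRatio n l = 0 :=
  prod_eq_zero (mem_range.2 h) (by simp)

theorem binomRatio_mem_Icc (n l : ℕ) : binomRatio n l ∈ Set.Icc (0 : ℝ) 1 := by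
  rcases lt_or_ge n l with h | h
  · simp [binomRatio_eq_zero h]
  · have hi : ∀ i ∈ range l, (0 : ℝ) ≤ n - i := fun i hi => by
      have : (i : ℝ) ≤ n := by exact_mod_cast (mem_range.1 hi).le.trans h
      linarith
    refine ⟨prod_nonneg fun i h' => div_nonneg (hi i h') (by positivity),
      prod_le_one (fun i h' => div_nonneg (hi i h') (by positivity)) fun i _ => ?_⟩
    rw [div_le_one (by positivity)]
    have : (0 : ℝ) ≤ i := by positivity
    linarith

theorem tendsto_binomRatio (l : ℕ) : Tendsto (fun n => binomRatio n l) atTop (𝓝 1) := by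
  have : ∀ i ∈ range l, Tendsto (fun n : ℕ => ((n : ℝ) - i) / (n + i + 1)) atTop (𝓝 1) := by
    intro i _
    have h : Tendsto (fun n : ℕ => 1 - (2 * i + 1 : ℝ) / ((n : ℝ) + (i + 1))) atTop (𝓝 (1 - 0)) :=
      tendsto_const_nhds.sub ((tendsto_atTop_add_const_right _ _
        tendsto_natCast_atTop_atTop).const_div_atTop _)
    rw [sub_zero] at h
    refine h.congr fun n => ?_
    have : (n : ℝ) + (i + 1) ≠ 0 := by positivity
    have : (n : ℝ) + i + 1 ≠ 0 := by positivity
    field_simp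
    ring
  simpa [binomRatio] using tendsto_finsetProd (range l) this

theorem binomRatio_succ_left (n l : ℕ) :
    (((n : ℝ) + 1) ^ 2 - l ^ 2) * binomRatio (n + 1) l = (n + 1) ^ 2 * binomRatio n l := by
  induction l with
  | zero => simp [binomRatio_zero]
  | succ l ih =>
    have h1 := binomRatio_succ (n + 1) l
    have h2 := binomRatio_succ n l
    push_cast at h1 ⊢
    have hne : (n : ℝ) + l + 1 ≠ 0 := by positivity
    apply mul_left_cancel₀ hne
    linear_combination ((n : ℝ) - l) * ih + (n + l + 1) * (n - l) * h1 - (n + 1) ^ 2 * h2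

/-- By `binomRatio_succ_left`, R(n, l) - R(n-1, l) = (l^2 / n^2) R(n, l). The extra top term of the
longer range is harmless because R(n, n+1) = 0. -/
theorem sum_binomRatio_sub (c : ℕ → ℝ) (n : ℕ) :
    ∑ l ∈ range (n + 1), c l * binomRatio (n + 1) (l + 1) -
      ∑ l ∈ range n, c l * binomRatio n (l + 1) =
      1 / ((n : ℝ) + 1) ^ 2 *
        ∑ l ∈ range (n + 1), c l * (l + 1) ^ 2 * binomRatio (n + 1) (l + 1) := by
  have : ∑ l ∈ range n, c l * binomRatio n (l + 1) =
      ∑ l ∈ range (n + 1), c l * binomRatio n (l + 1) := by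
    rw [sum_range_succ, binomRatio_eq_zero (Nat.lt_succ_self n)]
    simp
  rw [this, ← sum_sub_distrib, mul_sum]
  refine sum_congr rfl fun l _ => ?_
  have h := binomRatio_succ_left n (l + 1)
  push_cast at h
  have hne : (n : ℝ) + 1 ≠ 0 := by positivity
  field_simp
  linear_combination c l * h

/-- By `binomRatio_succ`, the difference of the two sides telescopes in (n - l) R(n, l) q(l). This
vanishes at l = n and leaves n q(0) at l = 0. -/
theorem sum_add_mul_binomRatio (q : ℕ → ℝ) (n : ℕ) :
    ∑ l ∈ range n, ((l : ℝ) + 1) * (q (l + 1) + q l) * binomRatio n (l + 1) =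
      n * (q 0 + ∑ l ∈ range n, (q (l + 1) - q l) * binomRatio n (l + 1)) := by
  have h : ∀ l ∈ range n,
      n * ((q (l + 1) - q l) * binomRatio n (l + 1)) -
        ((l : ℝ) + 1) * (q (l + 1) + q l) * binomRatio n (l + 1) =
      ((n : ℝ) - (l + 1 : ℕ)) * binomRatio n (l + 1) * q (l + 1) -
        (n - l) * binomRatio n l * q l := by
    intro l _
    rw [← binomRatio_succ n l]
    push_cast
    ring
  have hs := sum_congr rfl h
  rw [sum_range_sub (fun l : ℕ => ((n : ℝ) - l) * binomRatio n l * q l), sum_sub_distrib,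
    ← mul_sum] at hs
  simp only [sub_self, binomRatio_zero, Nat.cast_zero] at hs
  linarith

/-- The same telescoping with (-1)^l inserted, which exchanges the roles of sums and differences of
q. -/
theorem sum_alternating_mul_binomRatio (q : ℕ → ℝ) (n : ℕ) :
    n * ∑ l ∈ range n, (-1 : ℝ) ^ (l + 1) * (q (l + 1) + q l) * binomRatio n (l + 1) =
      ∑ l ∈ range n, (-1 : ℝ) ^ (l + 1) * ((l : ℝ) + 1) * (q (l + 1) - q l) * binomRatio n (l + 1)
        - n * q 0 := by
  have h : ∀ l ∈ range n,
      n * ((-1 : ℝ) ^ (l + 1) * (q (l + 1) + q l) * binomRatio n (l + 1)) -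
        (-1 : ℝ) ^ (l + 1) * ((l : ℝ) + 1) * (q (l + 1) - q l) * binomRatio n (l + 1) =
      (-1 : ℝ) ^ (l + 1) * (((n : ℝ) - (l + 1 : ℕ)) * binomRatio n (l + 1) * q (l + 1)) -
        (-1 : ℝ) ^ l * ((n - l) * binomRatio n l * q l) := by
    intro l _
    rw [← binomRatio_succ n l]
    push_cast
    ring
  have hs := sum_congr rfl h
  rw [sum_range_sub (fun l : ℕ => (-1 : ℝ) ^ l * (((n : ℝ) - l) * binomRatio n l * q l)),
    sum_sub_distrib, ← mul_sum] at hs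
  simp only [sub_self, binomRatio_zero, Nat.cast_zero] at hs
  linarith

/-! ### The finite identity for the truncated sums. -/

/-- The numbers `(-1) ^ l / l ^ 2` for `l = 1, 2, …`, indexed from `0`. -/
noncomputable def altInvSq (l : ℕ) : ℝ := (-1) ^ (l + 1) / ((l : ℝ) + 1) ^ 2

/-- The coefficient of `y ^ m` in `∏ l ∈ range L, (1 + altInvSq l * y) / (1 - altInvSq l * y)`. -/
noncomputable def ratioCoeff : ℕ → ℕ → ℝ
  | 0, _ => 1
  | m + 1, L => ∑ l ∈ range L, altInvSq l * (ratioCoeff m (l + 1) + ratioCoeff m l)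

theorem ratioCoeff_succ_zero (m : ℕ) : ratioCoeff (m + 1) 0 = 0 := by simp [ratioCoeff]

theorem ratioCoeff_succ_sub (m l : ℕ) : ratioCoeff (m + 1) (l + 1) - ratioCoeff (m + 1) l =
    altInvSq l * (ratioCoeff m (l + 1) + ratioCoeff m l) := by
  simp [ratioCoeff, sum_range_succ]

theorem ratioCoeff_succ_sub_mul_sq (m l : ℕ) :
    (ratioCoeff (m + 1) (l + 1) - ratioCoeff (m + 1) l) * ((l : ℝ) + 1) ^ 2 =
    (-1) ^ (l + 1) * (ratioCoeff m (l + 1) + ratioCoeff m l) := by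
  rw [ratioCoeff_succ_sub, altInvSq]
  field_simp

/-- The binomial transform of the increments of `ratioCoeff m`. -/
noncomputable def ratioTransform (m n : ℕ) : ℝ :=
  ratioCoeff m 0 +
    ∑ l ∈ range n, (ratioCoeff m (l + 1) - ratioCoeff m l) * binomRatio n (l + 1)

/-- The binomial transform that corresponds to one further summation with weight `1 / n`. -/
noncomputable def ratioTransformAux (m n : ℕ) : ℝ :=
  ∑ l ∈ range n, (-1 : ℝ) ^ (l + 1) * ((l : ℝ) + 1) *
    (ratioCoeff (m + 1) (l + 1) - ratioCoeff (m + 1) l) * binomRatio n (l + 1)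

/-- Differencing supplies the square that cancels the denominator of `altInvSq`, and the two signs
cancel. Telescoping then gives a factor n against 1/n^2, leaving the weight 1/n of the entry 1. -/
theorem ratioTransformAux_succ (m n : ℕ) :
    ratioTransformAux m (n + 1) - ratioTransformAux m n =
      1 / ((n : ℝ) + 1) * ratioTransform m (n + 1) := by
  have h := sum_add_mul_binomRatio (ratioCoeff m) (n + 1)
  rw [← ratioTransform] at h
  rw [ratioTransformAux, ratioTransformAux, sum_binomRatio_sub]
  have h' : ∀ l ∈ range (n + 1), (-1 : ℝ) ^ (l + 1) * ((l : ℝ) + 1) *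
      (ratioCoeff (m + 1) (l + 1) - ratioCoeff (m + 1) l) * ((l : ℝ) + 1) ^ 2 *
        binomRatio (n + 1) (l + 1) =
      ((l : ℝ) + 1) * (ratioCoeff m (l + 1) + ratioCoeff m l) * binomRatio (n + 1) (l + 1) := by
    intro l _
    have hs : (-1 : ℝ) ^ (l + 1) * (-1) ^ (l + 1) = 1 := by rw [← mul_pow]; simp
    linear_combination (-1 : ℝ) ^ (l + 1) * ((l : ℝ) + 1) * binomRatio (n + 1) (l + 1) *
      ratioCoeff_succ_sub_mul_sq m l + ((l : ℝ) + 1) * binomRatio (n + 1) (l + 1) *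
      (ratioCoeff m (l + 1) + ratioCoeff m l) * hs
  rw [sum_congr rfl h', h]
  push_cast
  field_simp

/-- Here the sign of `altInvSq` survives, so the alternating telescoping applies and contributes a
further 1/n: the entry 3. Its boundary term vanishes because `ratioCoeff (m + 1) 0 = 0`. -/
theorem ratioTransform_succ_succ (m n : ℕ) :
    ratioTransform (m + 2) (n + 1) - ratioTransform (m + 2) n =
      1 / ((n : ℝ) + 1) ^ 3 * ratioTransformAux m (n + 1) := by
  have h := sum_alternating_mul_binomRatio (ratioCoeff (m + 1)) (n + 1)
  rw [ratioCoeff_succ_zero, mul_zero, sub_zero, ← ratioTransformAux] at h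
  rw [ratioTransform, ratioTransform, add_sub_add_left_eq_sub, sum_binomRatio_sub, ← h]
  simp only [ratioCoeff_succ_sub_mul_sq]
  push_cast
  field_simp

/-- For constant q = 1 only the boundary term of the alternating telescoping remains; it produces
the final entry 2. -/
theorem ratioTransform_one_succ (n : ℕ) :
    ratioTransform 1 (n + 1) - ratioTransform 1 n = -(1 / ((n : ℝ) + 1) ^ 2) := by
  have h := sum_alternating_mul_binomRatio (ratioCoeff 0) (n + 1)
  rw [ratioTransform, ratioTransform, add_sub_add_left_eq_sub, sum_binomRatio_sub]
  simp only [ratioCoeff_succ_sub_mul_sq]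
  simp only [ratioCoeff, sub_self, mul_zero, zero_mul, sum_const_zero, zero_sub] at h ⊢
  have hne : ((n + 1 : ℕ) : ℝ) ≠ 0 := by positivity
  have h2 := mul_left_cancel₀ hne (h.trans (by ring : _ = ((n + 1 : ℕ) : ℝ) * (-1)))
  rw [h2]
  ring

/-- The multi-index `{3, 1}^d` for `m = 2 * d`, and `({3, 1}^d, 2)` for `m = 2 * d + 1`. -/
def threeOneIndex : ℕ → List ℕ
  | 0 => []
  | 1 => [2]
  | m + 2 => 3 :: 1 :: threeOneIndex m

theorem threeOneIndex_even (d : ℕ) : threeOneIndex (2 * d) = repeatIndex [3, 1] d := by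
  induction d with
  | zero => rfl
  | succ d ih =>
    rw [Nat.mul_succ, threeOneIndex, ih]
    rfl

theorem threeOneIndex_odd (d : ℕ) :
    threeOneIndex (2 * d + 1) = repeatIndex [3, 1] d ++ [2] := by
  induction d with
  | zero => rfl
  | succ d ih =>
    rw [show 2 * (d + 1) + 1 = (2 * d + 1) + 2 by ring, threeOneIndex, ih]
    rfl

theorem truncStar_threeOneIndex (m n : ℕ) :
    truncStar (threeOneIndex m) n = (-1) ^ m * ratioTransform m n := by
  induction m using Nat.twoStepInduction generalizing n with
  | zero => simp [threeOneIndex, truncStar, ratioTransform, ratioCoeff]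
  | one =>
    have h := sum_range_sub (ratioTransform 1) n
    simp only [ratioTransform_one_succ] at h
    have h0 : ratioTransform 1 0 = 0 := by simp [ratioTransform, ratioCoeff]
    rw [h0, sub_zero] at h
    rw [← h]
    simp [threeOneIndex, truncStar]
  | more m ih _ =>
    have h1 : ∀ n, truncStar (1 :: threeOneIndex m) n = (-1) ^ m * ratioTransformAux m n := by
      intro n
      have h := sum_range_sub (ratioTransformAux m) n
      have h0 : ratioTransformAux m 0 = 0 := by simp [ratioTransformAux]
      rw [h0, sub_zero] at h
      rw [← h, mul_sum, truncStar]
      refine sum_congr rfl fun j _ => ?_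
      rw [ih, ratioTransformAux_succ]
      push_cast
      ring
    have h := sum_range_sub (ratioTransform (m + 2)) n
    have h0 : ratioTransform (m + 2) 0 = 0 := by simp [ratioTransform, ratioCoeff]
    rw [h0, sub_zero] at h
    rw [← h, mul_sum, threeOneIndex, truncStar]
    refine sum_congr rfl fun j _ => ?_
    rw [h1, ratioTransform_succ_succ]
    push_cast
    ring

/-! ### Uniform bounds and the limit of the transforms. -/

theorem summable_inv_succ_sq : Summable fun l : ℕ => 1 / ((l : ℝ) + 1) ^ 2 := by
  have := (summable_nat_add_iff 1).2 (Real.summable_one_div_nat_pow.2 one_lt_two)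
  simpa using this

/-- The sum of the inverse squares. -/
noncomputable def invSqSum : ℝ := ∑' l : ℕ, 1 / ((l : ℝ) + 1) ^ 2

theorem invSqSum_nonneg : 0 ≤ invSqSum := tsum_nonneg fun l => by positivity

theorem abs_altInvSq (l : ℕ) : |altInvSq l| = 1 / ((l : ℝ) + 1) ^ 2 := by
  rw [altInvSq, abs_div, abs_pow, abs_neg, abs_one, one_pow, abs_of_nonneg (by positivity)]

theorem abs_ratioCoeff_le (m L : ℕ) : |ratioCoeff m L| ≤ (2 * invSqSum) ^ m := by
  induction m generalizing L with
  | zero => simp [ratioCoeff]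
  | succ m ih =>
    calc |ratioCoeff (m + 1) L|
        ≤ ∑ l ∈ range L, |altInvSq l * (ratioCoeff m (l + 1) + ratioCoeff m l)| :=
          abs_sum_le_sum_abs _ _
      _ ≤ ∑ l ∈ range L, 1 / ((l : ℝ) + 1) ^ 2 * (2 * (2 * invSqSum) ^ m) := by
          refine sum_le_sum fun l _ => ?_
          rw [abs_mul, abs_altInvSq]
          refine mul_le_mul_of_nonneg_left ?_ (by positivity)
          have := abs_add_le (ratioCoeff m (l + 1)) (ratioCoeff m l)
          linarith [ih (l + 1), ih l]
      _ = (∑ l ∈ range L, 1 / ((l : ℝ) + 1) ^ 2) * (2 * (2 * invSqSum) ^ m) := by rw [sum_mul]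
      _ ≤ invSqSum * (2 * (2 * invSqSum) ^ m) := by
          have := invSqSum_nonneg
          exact mul_le_mul_of_nonneg_right
            (summable_inv_succ_sq.sum_le_tsum _ fun l _ => by positivity) (by positivity)
      _ = _ := by ring

theorem abs_ratioCoeff_sub_le (m l : ℕ) : |ratioCoeff m (l + 1) - ratioCoeff m l| ≤
    2 * (2 * invSqSum) ^ (m - 1) * (1 / ((l : ℝ) + 1) ^ 2) := by
  have := invSqSum_nonneg
  cases m with
  | zero =>
    simp only [ratioCoeff, sub_self, abs_zero]
    positivity
  | succ m =>
    rw [ratioCoeff_succ_sub, abs_mul, abs_altInvSq, mul_comm, Nat.add_sub_cancel]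
    refine mul_le_mul_of_nonneg_right ?_ (by positivity)
    have := abs_add_le (ratioCoeff m (l + 1)) (ratioCoeff m l)
    linarith [abs_ratioCoeff_le m (l + 1), abs_ratioCoeff_le m l]

theorem summable_ratioCoeff_sub (m : ℕ) :
    Summable fun l => ratioCoeff m (l + 1) - ratioCoeff m l :=
  Summable.of_norm_bounded (summable_inv_succ_sq.mul_left _) (abs_ratioCoeff_sub_le m)

/-- The limit of `ratioCoeff m L` as `L → ∞`. -/
noncomputable def ratioLimit (m : ℕ) : ℝ :=
  ratioCoeff m 0 + ∑' l, (ratioCoeff m (l + 1) - ratioCoeff m l)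

theorem tendsto_ratioCoeff (m : ℕ) : Tendsto (ratioCoeff m) atTop (𝓝 (ratioLimit m)) := by
  have h := ((summable_ratioCoeff_sub m).hasSum.tendsto_sum_nat).const_add (ratioCoeff m 0)
  refine h.congr fun n => ?_
  rw [sum_range_sub]
  ring

/-- Dominated convergence: R(n, l) lies in [0, 1] and tends to 1, while the increments of
`ratioCoeff m` are O(1/l^2). -/
theorem tendsto_ratioTransform (m : ℕ) :
    Tendsto (ratioTransform m) atTop (𝓝 (ratioLimit m)) := by
  have h : Tendsto (fun n => ∑' l, (ratioCoeff m (l + 1) - ratioCoeff m l) * binomRatio n (l + 1))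
      atTop (𝓝 (∑' l, (ratioCoeff m (l + 1) - ratioCoeff m l))) := by
    refine tendsto_tsum_of_dominated_convergence (summable_ratioCoeff_sub m).abs
      (fun l => ?_) (Eventually.of_forall fun n l => ?_)
    · simpa using (tendsto_binomRatio (l + 1)).const_mul (ratioCoeff m (l + 1) - ratioCoeff m l)
    · obtain ⟨h0, h1⟩ := binomRatio_mem_Icc n (l + 1)
      rw [Real.norm_eq_abs, abs_mul, abs_of_nonneg h0]
      exact mul_le_of_le_one_right (abs_nonneg _) h1
  refine (h.const_add (ratioCoeff m 0)).congr fun n => ?_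
  rw [ratioTransform, tsum_eq_sum (s := range n)]
  intro l hl
  rw [binomRatio_eq_zero (by simp at hl; omega), mul_zero]

theorem hasSum_zetaStarTerm_threeOneIndex (m : ℕ) :
    HasSum (zetaStarTerm (threeOneIndex m)) ((-1) ^ m * ratioLimit m) := by
  refine hasSum_zetaStarTerm (((tendsto_ratioTransform m).const_mul _).congr fun n => ?_)
  rw [truncStar_threeOneIndex]

/-! ### The generating function and Euler's sine product. -/

theorem norm_ratioCoeff_mul_pow_le (m L : ℕ) (y : ℂ) :
    ‖(ratioCoeff m L : ℂ) * y ^ m‖ ≤ (2 * invSqSum * ‖y‖) ^ m := by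
  rw [norm_mul, norm_pow, Complex.norm_real, mul_pow]
  exact mul_le_mul_of_nonneg_right (abs_ratioCoeff_le m L) (by positivity)

theorem norm_ratioLimit_mul_pow_le (m : ℕ) (y : ℂ) :
    ‖(ratioLimit m : ℂ) * y ^ m‖ ≤ (2 * invSqSum * ‖y‖) ^ m := by
  rw [norm_mul, norm_pow, Complex.norm_real, mul_pow]
  refine mul_le_mul_of_nonneg_right ?_ (by positivity)
  exact le_of_tendsto (tendsto_ratioCoeff m).abs
    (Eventually.of_forall fun L => abs_ratioCoeff_le m L)

theorem summable_geometric_bound {y : ℂ} (hy : 2 * invSqSum * ‖y‖ < 1) :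
    Summable fun m : ℕ => (2 * invSqSum * ‖y‖) ^ m :=
  summable_geometric_of_lt_one (by have := invSqSum_nonneg; positivity) hy

theorem tsum_ratioCoeff_mul_prod {y : ℂ} (hy : 2 * invSqSum * ‖y‖ < 1) (L : ℕ) :
    (∑' m, (ratioCoeff m L : ℂ) * y ^ m) * ∏ l ∈ range L, (1 - (altInvSq l : ℂ) * y) =
      ∏ l ∈ range L, (1 + (altInvSq l : ℂ) * y) := by
  have hs : ∀ L, Summable fun m => (ratioCoeff m L : ℂ) * y ^ m := fun L =>
    Summable.of_norm_bounded (summable_geometric_bound hy)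
      (fun m => norm_ratioCoeff_mul_pow_le m L y)
  induction L with
  | zero =>
    rw [tsum_eq_single 0]
    · simp [ratioCoeff]
    · intro m hm
      obtain ⟨m, rfl⟩ := Nat.exists_eq_succ_of_ne_zero hm
      simp [ratioCoeff_succ_zero]
  | succ L ih =>
    have hrec : (∑' m, (ratioCoeff m (L + 1) : ℂ) * y ^ m) * (1 - (altInvSq L : ℂ) * y) =
        (∑' m, (ratioCoeff m L : ℂ) * y ^ m) * (1 + (altInvSq L : ℂ) * y) := by
      have hterm : ∀ m, (ratioCoeff (m + 1) (L + 1) : ℂ) * y ^ (m + 1) =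
          (ratioCoeff (m + 1) L : ℂ) * y ^ (m + 1) + (altInvSq L : ℂ) * y *
            ((ratioCoeff m (L + 1) : ℂ) * y ^ m + (ratioCoeff m L : ℂ) * y ^ m) := by
        intro m
        have := congrArg (fun t : ℝ => (t : ℂ)) (ratioCoeff_succ_sub m L)
        push_cast at this
        linear_combination y ^ (m + 1) * this
      have e1 := (hs (L + 1)).tsum_eq_zero_add
      have e2 := (hs L).tsum_eq_zero_add
      have e3 : ∑' m, (ratioCoeff (m + 1) (L + 1) : ℂ) * y ^ (m + 1) =
          ∑' m, (ratioCoeff (m + 1) L : ℂ) * y ^ (m + 1) + (altInvSq L : ℂ) * y *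
            (∑' m, (ratioCoeff m (L + 1) : ℂ) * y ^ m + ∑' m, (ratioCoeff m L : ℂ) * y ^ m) := by
        rw [← (hs (L + 1)).tsum_add (hs L), ← tsum_mul_left, ← Summable.tsum_add]
        · exact tsum_congr hterm
        · exact (summable_nat_add_iff 1).2 (hs L)
        · exact ((hs (L + 1)).add (hs L)).mul_left _
      simp only [ratioCoeff, Complex.ofReal_one, pow_zero, mul_one] at e1 e2
      have e1' : ∑' m, (ratioCoeff m (L + 1) : ℂ) * y ^ m =
        1 + ∑' m, (ratioCoeff (m + 1) (L + 1) : ℂ) * y ^ (m + 1) := e1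
      have e2' : ∑' m, (ratioCoeff m L : ℂ) * y ^ m =
        1 + ∑' m, (ratioCoeff (m + 1) L : ℂ) * y ^ (m + 1) := e2
      linear_combination e1' - e2' + e3
    rw [prod_range_succ, prod_range_succ, ← ih]
    linear_combination (∏ l ∈ range L, (1 - (altInvSq l : ℂ) * y)) * hrec

theorem tendsto_tsum_ratioCoeff {y : ℂ} (hy : 2 * invSqSum * ‖y‖ < 1) :
    Tendsto (fun L => ∑' m, (ratioCoeff m L : ℂ) * y ^ m) atTop
      (𝓝 (∑' m, (ratioLimit m : ℂ) * y ^ m)) :=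
  tendsto_tsum_of_dominated_convergence (summable_geometric_bound hy)
    (fun m => ((Complex.continuous_ofReal.tendsto _).comp (tendsto_ratioCoeff m)).mul_const _)
    (Eventually.of_forall fun L m => norm_ratioCoeff_mul_pow_le m L y)

/-- The partial products of Euler's product for the sine. -/
noncomputable def sineProd (n : ℕ) (z : ℂ) : ℂ := ∏ j ∈ range n, (1 - z ^ 2 / ((j : ℂ) + 1) ^ 2)

/-- Even l give the factors of the sine product at z/2. Odd l give those at iz with its even factors
removed, and these even factors form the product at iz/2. -/
theorem prod_altInvSq_mul_sineProd (n : ℕ) (z : ℂ) :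
    (∏ l ∈ range (2 * n), (1 - (altInvSq l : ℂ) * z ^ 2)) * sineProd n (Complex.I * z / 2) =
      sineProd (2 * n) (Complex.I * z) * sineProd n (z / 2) := by
  induction n with
  | zero => simp [sineProd]
  | succ n ih =>
    simp only [sineProd] at ih ⊢
    rw [show 2 * (n + 1) = 2 * n + 1 + 1 by ring]
    simp only [prod_range_succ]
    have ha : (altInvSq (2 * n) : ℂ) = -1 / ((2 * n : ℕ) + 1) ^ 2 := by
      simp [altInvSq, pow_succ, pow_mul]
    have hb : (altInvSq (2 * n + 1) : ℂ) = 1 / ((2 * n + 1 : ℕ) + 1) ^ 2 := by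
      simp [altInvSq, pow_succ, pow_mul]
    have hc : ((n : ℂ) + 1) ^ 2 = (((2 * n + 1 : ℕ) : ℂ) + 1) ^ 2 / 4 := by
      push_cast
      ring
    rw [ha, hb, hc]
    have hI : Complex.I ^ 2 = -1 := Complex.I_sq
    have h1 : (1 : ℂ) - -1 / ((2 * n : ℕ) + 1) ^ 2 * z ^ 2 =
        1 - (Complex.I * z) ^ 2 / ((2 * n : ℕ) + 1) ^ 2 := by
      rw [mul_pow, hI]
      ring
    have h2 : (1 : ℂ) - 1 / ((2 * n + 1 : ℕ) + 1) ^ 2 * z ^ 2 =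
        1 - (z / 2) ^ 2 / ((((2 * n + 1 : ℕ) : ℂ) + 1) ^ 2 / 4) := by
      generalize ((2 * n + 1 : ℕ) : ℂ) + 1 = t
      ring
    have h3 : (1 : ℂ) - (Complex.I * z / 2) ^ 2 / ((((2 * n + 1 : ℕ) : ℂ) + 1) ^ 2 / 4) =
        1 - (Complex.I * z) ^ 2 / ((2 * n + 1 : ℕ) + 1) ^ 2 := by
      generalize ((2 * n + 1 : ℕ) : ℂ) + 1 = t
      ring
    rw [h1, h2, h3]
    linear_combination (1 - (Complex.I * z) ^ 2 / ((2 * n : ℕ) + 1) ^ 2) *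
      (1 - (z / 2) ^ 2 / ((((2 * n + 1 : ℕ) : ℂ) + 1) ^ 2 / 4)) *
      (1 - (Complex.I * z) ^ 2 / ((2 * n + 1 : ℕ) + 1) ^ 2) * ih

theorem tendsto_sineProd (z : ℂ) :
    Tendsto (fun n => Real.pi * z * sineProd n z) atTop (𝓝 (Complex.sin (Real.pi * z))) :=
  Complex.tendsto_euler_sin_prod z

theorem tsum_ratioLimit_mul_sin {z : ℂ} (hz : 2 * invSqSum * ‖z‖ ^ 2 < 1) :
    (∑' m, (ratioLimit m : ℂ) * (-z ^ 2) ^ m) *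
      (Complex.sin (Real.pi * z) * Complex.sin (Real.pi * (Complex.I * z / 2)) ^ 2) =
    Complex.I * (Complex.sin (Real.pi * (Complex.I * z)) * Complex.sin (Real.pi * (z / 2)) ^ 2) := by
  have hy : 2 * invSqSum * ‖-z ^ 2‖ < 1 := by rwa [norm_neg, norm_pow]
  have hdouble : Tendsto (fun n : ℕ => 2 * n) atTop atTop :=
    tendsto_id.const_mul_atTop' two_pos
  have hleft := ((tendsto_tsum_ratioCoeff hy).comp hdouble).mul
    (((tendsto_sineProd z).comp hdouble).mul ((tendsto_sineProd (Complex.I * z / 2)).pow 2))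
  have hright := ((((tendsto_sineProd (Complex.I * z)).comp hdouble).mul
    ((tendsto_sineProd (z / 2)).pow 2)).const_mul Complex.I)
  refine tendsto_nhds_unique (hleft.congr fun n => ?_) hright
  simp only [Function.comp_apply]
  have h0 := tsum_ratioCoeff_mul_prod hy (2 * n)
  have h1 := prod_altInvSq_mul_sineProd n z
  -- Replacing z by iz changes the sign of z^2, turning the numerator product into the denominator
  -- product.
  have h2 := prod_altInvSq_mul_sineProd n (Complex.I * z)
  have hI : Complex.I ^ 2 = -1 := Complex.I_sq
  have e1 : sineProd n (Complex.I * (Complex.I * z) / 2) = sineProd n (z / 2) := by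
    simp only [sineProd, div_pow, mul_pow, hI, neg_mul, one_mul, neg_neg]
  have e2 : sineProd (2 * n) (Complex.I * (Complex.I * z)) = sineProd (2 * n) z := by
    simp only [sineProd, mul_pow, hI, neg_mul, one_mul, neg_neg]
  rw [e1, e2] at h2
  simp only [mul_pow, hI, neg_mul, one_mul, mul_neg, sub_neg_eq_add, ← sub_eq_add_neg] at h0 h2
  generalize (∑' m, (ratioCoeff m (2 * n) : ℂ) * (-z ^ 2) ^ m) = F at *
  generalize ∏ l ∈ range (2 * n), (1 + (altInvSq l : ℂ) * z ^ 2) = P at *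
  generalize ∏ l ∈ range (2 * n), (1 - (altInvSq l : ℂ) * z ^ 2) = M at *
  generalize sineProd (2 * n) z = a at *
  generalize sineProd (2 * n) (Complex.I * z) = b at *
  generalize sineProd n (Complex.I * z / 2) = c at *
  generalize sineProd n (z / 2) = d at *
  have key : F * a * c ^ 2 = b * d ^ 2 := by
    linear_combination (-F * c) * h2 + d * h1 + c * d * h0
  linear_combination (Real.pi * z) * (Real.pi * Complex.I * z / 2) ^ 2 * key

/-! ### From analytic identities to formal power series. -/

/-- The power series `f` converges absolutely to `φ` near `0`. -/
def PowerSeries.Represents (f : PowerSeries ℂ) (φ : ℂ → ℂ) : Prop :=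
  ∀ᶠ z in 𝓝 (0 : ℂ), (Summable fun n => ‖coeff n f * z ^ n‖) ∧ ∑' n, coeff n f * z ^ n = φ z

namespace PowerSeries

theorem Represents.sub {f g : PowerSeries ℂ} {φ ψ : ℂ → ℂ} (hf : f.Represents φ)
    (hg : g.Represents ψ) : (f - g).Represents fun z => φ z - ψ z := by
  filter_upwards [hf, hg] with z hfz hgz
  have hterm : ∀ n, coeff n (f - g) * z ^ n = coeff n f * z ^ n - coeff n g * z ^ n := by
    intro n
    rw [map_sub, sub_mul]
  simp only [hterm]
  refine ⟨Summable.of_nonneg_of_le (fun n => norm_nonneg _) (fun n => norm_sub_le _ _)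
    (hfz.1.add hgz.1), ?_⟩
  rw [hfz.1.of_norm.tsum_sub hgz.1.of_norm, hfz.2, hgz.2]

theorem Represents.mul {f g : PowerSeries ℂ} {φ ψ : ℂ → ℂ} (hf : f.Represents φ)
    (hg : g.Represents ψ) : (f * g).Represents fun z => φ z * ψ z := by
  filter_upwards [hf, hg] with z hfz hgz
  have hterm : ∀ n, coeff n (f * g) * z ^ n =
      ∑ p ∈ antidiagonal n, coeff p.1 f * z ^ p.1 * (coeff p.2 g * z ^ p.2) := by
    intro n
    rw [coeff_mul, sum_mul]
    refine sum_congr rfl fun p hp => ?_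
    rw [← mem_antidiagonal.1 hp]
    ring
  have hsum := summable_norm_sum_mul_antidiagonal_of_summable_norm
    (f := fun n => coeff n f * z ^ n) (g := fun n => coeff n g * z ^ n) hfz.1 hgz.1
  have hprod := tsum_mul_tsum_eq_tsum_sum_antidiagonal_of_summable_norm
    (f := fun n => coeff n f * z ^ n) (g := fun n => coeff n g * z ^ n) hfz.1 hgz.1
  rw [hfz.2, hgz.2] at hprod
  exact ⟨hsum.congr fun n => by rw [hterm], (tsum_congr hterm).trans hprod.symm⟩

theorem represents_C (a : ℂ) : (C a : PowerSeries ℂ).Represents fun _ => a := by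
  refine Eventually.of_forall fun z => ?_
  have h0 : ∀ n ∉ ({0} : Finset ℕ), coeff n (C a : PowerSeries ℂ) * z ^ n = 0 := by
    intro n hn
    rw [coeff_C, if_neg (by simpa using hn), zero_mul]
  refine ⟨summable_of_ne_finset_zero (s := {0}) fun n hn => by rw [h0 n hn, norm_zero], ?_⟩
  rw [tsum_eq_sum h0]
  simp

theorem represents_exp (c : ℂ) :
    (rescale c (exp ℂ)).Represents fun z => Complex.exp (c * z) := by
  refine Eventually.of_forall fun z => ?_
  have hterm : ∀ n, coeff n (rescale c (exp ℂ)) * z ^ n = (c * z) ^ n / n.factorial := by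
    intro n
    rw [coeff_rescale, coeff_exp]
    simp
    ring
  simp only [hterm]
  refine ⟨NormedSpace.norm_expSeries_div_summable (c * z), ?_⟩
  rw [Complex.exp_eq_exp_ℂ, NormedSpace.exp_eq_tsum_div]

theorem Represents.unique {f g : PowerSeries ℂ} {φ ψ : ℂ → ℂ} (hf : f.Represents φ)
    (hg : g.Represents ψ) (h : ∀ᶠ z in 𝓝 0, φ z = ψ z) : f = g := by
  have key : ∀ {f : PowerSeries ℂ} {χ : ℂ → ℂ}, f.Represents χ →
      HasFPowerSeriesAt χ (FormalMultilinearSeries.ofScalars ℂ fun n => coeff n f) 0 := by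
    intro f χ hf
    rw [hasFPowerSeriesAt_iff]
    filter_upwards [hf] with z hz
    rw [zero_add, ← hz.2]
    simpa only [FormalMultilinearSeries.coeff_ofScalars, smul_eq_mul, mul_comm] using
      hz.1.of_norm.hasSum
  have := (key hf).eq_formalMultilinearSeries_of_eventually (key hg) h
  ext n
  exact congrFun (FormalMultilinearSeries.ofScalars_series_injective ℂ ℂ this) n

end PowerSeries

open PowerSeries

/-- The generating series of the values `ζ⋆({3, 1}^d)` and `ζ⋆({3, 1}^d, 2)`. -/
noncomputable def starSeries : PowerSeries ℂ :=
  PowerSeries.mk fun n => if Even n then (((-1) ^ (n / 2) * ratioLimit (n / 2) : ℝ) : ℂ) else 0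

theorem coeff_starSeries_even (m : ℕ) :
    coeff (2 * m) starSeries = (((-1) ^ m * ratioLimit m : ℝ) : ℂ) := by
  simp [starSeries]

theorem eventually_norm_sq_lt : ∀ᶠ z : ℂ in 𝓝 0, 2 * invSqSum * ‖z‖ ^ 2 < 1 := by
  have : Tendsto (fun z : ℂ => 2 * invSqSum * ‖z‖ ^ 2) (𝓝 0) (𝓝 (2 * invSqSum * ‖(0 : ℂ)‖ ^ 2)) :=
    Continuous.tendsto (by fun_prop) 0
  exact this.eventually (gt_mem_nhds (by simp))

theorem represents_starSeries :
    starSeries.Represents fun z => ∑' m, (ratioLimit m : ℂ) * (-z ^ 2) ^ m := by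
  filter_upwards [eventually_norm_sq_lt] with z hz
  have hy : 2 * invSqSum * ‖-z ^ 2‖ < 1 := by rwa [norm_neg, norm_pow]
  have hinj : Function.Injective fun m : ℕ => 2 * m := fun a b h => by simpa using h
  have heven : ∀ m, coeff (2 * m) starSeries * z ^ (2 * m) =
      (ratioLimit m : ℂ) * (-z ^ 2) ^ m := by
    intro m
    rw [coeff_starSeries_even, neg_pow (z ^ 2), ← pow_mul]
    push_cast
    ring
  have hodd : ∀ n ∉ Set.range (fun m : ℕ => 2 * m), coeff n starSeries * z ^ n = 0 := by
    intro n hn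
    rw [starSeries, coeff_mk, if_neg, zero_mul]
    rintro ⟨m, hm⟩
    exact hn ⟨m, by simp only; omega⟩
  constructor
  · rw [← hinj.summable_iff (fun n hn => by rw [hodd n hn, norm_zero])]
    refine Summable.of_nonneg_of_le (fun _ => norm_nonneg _) (fun m => ?_)
      (summable_geometric_bound hy)
    simp only [Function.comp_apply, heven]
    exact norm_ratioLimit_mul_pow_le m _
  · rw [← hinj.tsum_eq (Function.support_subset_iff'.2 hodd)]
    exact tsum_congr heven

/-! ### The tangent–hyperbolic cotangent form and Bernoulli series. -/

/-- The formal exponential `exp (c * X)`. -/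
noncomputable abbrev expSeries (c : ℂ) : PowerSeries ℂ := rescale c (PowerSeries.exp ℂ)

theorem expSeries_mul (a b : ℂ) : expSeries a * expSeries b = expSeries (a + b) :=
  exp_mul_exp_eq_exp_add a b

theorem expSeries_mul_neg (a : ℂ) : expSeries a * expSeries (-a) = 1 := by
  rw [expSeries_mul, add_neg_cancel]
  simp [expSeries]

theorem expSeries_half_sq (a : ℂ) : expSeries (a / 2) ^ 2 = expSeries a := by
  rw [sq, expSeries_mul, add_halves]

theorem expSeries_sub_ne_zero {a b : ℂ} (h : a ≠ b) : expSeries a - expSeries b ≠ 0 := by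
  intro h0
  have := congrArg (coeff 1) h0
  simp [expSeries, coeff_rescale, coeff_exp] at this
  exact h (sub_eq_zero.1 this)

theorem starSeries_mul_expSeries :
    starSeries * ((expSeries (-(Complex.I * Real.pi)) - expSeries (Complex.I * Real.pi)) *
      ((expSeries (Real.pi / 2) - expSeries (-(Real.pi / 2))) *
        (expSeries (Real.pi / 2) - expSeries (-(Real.pi / 2))))) =
    C Complex.I * ((expSeries Real.pi - expSeries (-Real.pi)) *
      ((expSeries (-(Complex.I * Real.pi / 2)) - expSeries (Complex.I * Real.pi / 2)) *
        (expSeries (-(Complex.I * Real.pi / 2)) - expSeries (Complex.I * Real.pi / 2)))) := by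
  have hexp := fun a b : ℂ => (represents_exp a).sub (represents_exp b)
  refine (represents_starSeries.mul ((hexp _ _).mul ((hexp _ _).mul (hexp _ _)))).unique
    ((represents_C _).mul ((hexp _ _).mul ((hexp _ _).mul (hexp _ _)))) ?_
  filter_upwards [eventually_norm_sq_lt] with z hz
  have h := tsum_ratioLimit_mul_sin hz
  simp only [Complex.sin] at h
  have hI : Complex.I * Complex.I = -1 := Complex.I_mul_I
  have e1 : -(Real.pi * z : ℂ) * Complex.I = -(Complex.I * Real.pi) * z := by ring
  have e2 : (Real.pi * z : ℂ) * Complex.I = Complex.I * Real.pi * z := by ring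
  have e3 : -(Real.pi * (Complex.I * z / 2) : ℂ) * Complex.I = Real.pi / 2 * z := by
    linear_combination (-(Real.pi * z / 2) : ℂ) * hI
  have e4 : (Real.pi * (Complex.I * z / 2) : ℂ) * Complex.I = -(Real.pi / 2) * z := by
    linear_combination (Real.pi * z / 2 : ℂ) * hI
  have e5 : -(Real.pi * (Complex.I * z) : ℂ) * Complex.I = Real.pi * z := by
    linear_combination (-(Real.pi * z) : ℂ) * hI
  have e6 : (Real.pi * (Complex.I * z) : ℂ) * Complex.I = -Real.pi * z := by
    linear_combination (Real.pi * z : ℂ) * hI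
  have e7 : -(Real.pi * (z / 2) : ℂ) * Complex.I = -(Complex.I * Real.pi / 2) * z := by ring
  have e8 : (Real.pi * (z / 2) : ℂ) * Complex.I = Complex.I * Real.pi / 2 * z := by ring
  rw [e1, e2, e3, e4, e5, e6, e7, e8] at h
  -- Each side has three sines, and each sine carries a factor i/2 in exponential form.
  have hne : (Complex.I / 2) ^ 3 ≠ 0 := pow_ne_zero _ (div_ne_zero Complex.I_ne_zero two_ne_zero)
  apply mul_left_cancel₀ hne
  linear_combination h

/-- Cleared of denominators, this is `starSeries` = tan(πX/2) coth(πX/2). It follows by the double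
angle formula and cancellation, legitimate because formal power series over ℂ form a domain. -/
theorem starSeries_mul :
    starSeries * ((expSeries (Complex.I * Real.pi / 2) + expSeries (-(Complex.I * Real.pi / 2))) *
      (expSeries (Real.pi / 2) - expSeries (-(Real.pi / 2)))) =
    C Complex.I * ((expSeries (Real.pi / 2) + expSeries (-(Real.pi / 2))) *
      (expSeries (-(Complex.I * Real.pi / 2)) - expSeries (Complex.I * Real.pi / 2))) := by
  have hpi : (Real.pi : ℂ) ≠ 0 := Complex.ofReal_ne_zero.2 Real.pi_ne_zero
  have h := starSeries_mul_expSeries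
  rw [← expSeries_half_sq (Complex.I * Real.pi), ← expSeries_half_sq (-(Complex.I * Real.pi)),
    ← expSeries_half_sq Real.pi, ← expSeries_half_sq (-Real.pi), neg_div, neg_div] at h
  have h1 : expSeries (-(Complex.I * Real.pi / 2)) - expSeries (Complex.I * Real.pi / 2) ≠ 0 := by
    apply expSeries_sub_ne_zero
    intro hc
    have : Complex.I * Real.pi = 0 := by linear_combination -hc
    exact mul_ne_zero Complex.I_ne_zero hpi this
  have h2 : expSeries (Real.pi / 2) - expSeries (-(Real.pi / 2)) ≠ 0 := by
    apply expSeries_sub_ne_zero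
    intro hc
    exact hpi (by linear_combination hc)
  apply mul_left_cancel₀ (mul_ne_zero h1 h2)
  linear_combination h

/-- The series `∑ (c ^ n + (-c) ^ n) * B_n / n! * X ^ n`, twice the even part of the generating
series of the Bernoulli numbers. -/
noncomputable def evenBernoulli (c : ℂ) : PowerSeries ℂ :=
  rescale c (bernoulliPowerSeries ℂ) + rescale (-c) (bernoulliPowerSeries ℂ)

theorem coeff_evenBernoulli (c : ℂ) (n : ℕ) :
    coeff n (evenBernoulli c) = (c ^ n + (-c) ^ n) * ((bernoulli n : ℂ) / n.factorial) := by
  simp [evenBernoulli, bernoulliPowerSeries, coeff_rescale]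
  ring

theorem rescale_bernoulliPowerSeries_mul (c : ℂ) :
    rescale c (bernoulliPowerSeries ℂ) * (expSeries c - 1) = C c * X := by
  have h := congrArg (rescale c) (bernoulliPowerSeries_mul_exp_sub_one ℂ)
  rwa [map_mul, map_sub, map_one, rescale_X] at h

/-- The identity t/(e^t - 1) + (-t)/(e^(-t) - 1) = t coth(t/2) at t = cX, free of division. -/
theorem evenBernoulli_mul (c : ℂ) :
    evenBernoulli c * (expSeries (c / 2) - expSeries (-(c / 2))) =
      C c * X * (expSeries (c / 2) + expSeries (-(c / 2))) := by
  have h1 := rescale_bernoulliPowerSeries_mul c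
  have h2 := rescale_bernoulliPowerSeries_mul (-c)
  rw [← expSeries_half_sq] at h1 h2
  rw [neg_div, map_neg] at h2
  have h3 := expSeries_mul_neg (c / 2)
  rw [evenBernoulli]
  generalize expSeries (c / 2) = h at *
  generalize expSeries (-(c / 2)) = h' at *
  generalize rescale c (bernoulliPowerSeries ℂ) = b at *
  generalize rescale (-c) (bernoulliPowerSeries ℂ) = b' at *
  linear_combination h' * h1 - h * h2 - (b * h - b' * h') * h3

theorem evenBernoulli_mul_evenBernoulli_sub :
    evenBernoulli Real.pi *
      (evenBernoulli (Complex.I * Real.pi) - evenBernoulli (2 * (Complex.I * Real.pi))) =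
    C ((Real.pi : ℂ) ^ 2) * X ^ 2 * starSeries := by
  have hpi : (Real.pi : ℂ) ≠ 0 := Complex.ofReal_ne_zero.2 Real.pi_ne_zero
  have hS := starSeries_mul
  have hU := evenBernoulli_mul Real.pi
  have hV := evenBernoulli_mul (Complex.I * Real.pi)
  have hW := evenBernoulli_mul (2 * (Complex.I * Real.pi))
  rw [mul_div_cancel_left₀ _ (two_ne_zero' ℂ), ← expSeries_half_sq (Complex.I * Real.pi),
    ← expSeries_half_sq (-(Complex.I * Real.pi)), neg_div] at hW
  have h1 : expSeries (Complex.I * Real.pi / 2) - expSeries (-(Complex.I * Real.pi / 2)) ≠ 0 := by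
    apply expSeries_sub_ne_zero
    intro hc
    have : Complex.I * Real.pi = 0 := by linear_combination hc
    exact mul_ne_zero Complex.I_ne_zero hpi this
  have h2 : expSeries (Real.pi / 2) - expSeries (-(Real.pi / 2)) ≠ 0 := by
    apply expSeries_sub_ne_zero
    intro hc
    exact hpi (by linear_combination hc)
  have h3 : expSeries (Complex.I * Real.pi / 2) + expSeries (-(Complex.I * Real.pi / 2)) ≠ 0 := by
    intro h0
    have := congrArg (coeff 0) h0
    rw [map_add, coeff_rescale, coeff_rescale, coeff_exp] at this
    norm_num at this
  simp only [map_mul, map_pow, map_ofNat] at hU hV hW ⊢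
  generalize expSeries (Complex.I * Real.pi / 2) = p at *
  generalize expSeries (-(Complex.I * Real.pi / 2)) = p' at *
  generalize expSeries (Real.pi / 2) = h at *
  generalize expSeries (-(Real.pi / 2)) = h' at *
  generalize evenBernoulli Real.pi = U at *
  generalize evenBernoulli (Complex.I * Real.pi) = V at *
  generalize evenBernoulli (2 * (Complex.I * Real.pi)) = W at *
  generalize (C Complex.I : PowerSeries ℂ) = i at *
  generalize (C (Real.pi : ℂ) : PowerSeries ℂ) = q at *
  -- This is cot x - 2 cot 2x = tan x with x = πX/2.
  have hY : (V - W) * (p + p') = -(i * q * X * (p - p')) := by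
    apply mul_left_cancel₀ h1
    linear_combination (p + p') * hV - hW
  apply mul_left_cancel₀ (mul_ne_zero h3 h2)
  linear_combination (h - h') * U * hY - i * q * X * (p - p') * hU - q ^ 2 * X ^ 2 * hS

/-! ### Comparison of coefficients. -/

theorem sum_range_two_mul_add_one {M : Type*} [AddCommMonoid M] (f : ℕ → M) (N : ℕ) :
    ∑ b ∈ range (2 * N + 1), f b = f 0 + ∑ k ∈ range N, (f (2 * k + 1) + f (2 * k + 2)) := by
  induction N with
  | zero => simp
  | succ N ih =>
    rw [show 2 * (N + 1) + 1 = 2 * N + 1 + 1 + 1 by ring, sum_range_succ, sum_range_succ, ih,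
      sum_range_succ _ N, add_assoc, add_assoc]

theorem ratioLimit_eq (m : ℕ) :
    (-1) ^ m * ratioLimit m = 4 * Real.pi ^ (2 * m) * ∑ k ∈ range (m + 1),
      (-1 : ℝ) ^ k * (4 ^ (k + 1) - 1) *
        ((bernoulli (2 * k + 2) : ℝ) / ((2 * k + 2).factorial : ℝ)) *
        ((bernoulli (2 * m - 2 * k) : ℝ) / ((2 * m - 2 * k).factorial : ℝ)) := by
  have hpi : (Real.pi : ℂ) ≠ 0 := Complex.ofReal_ne_zero.2 Real.pi_ne_zero
  have h := congrArg (coeff (2 * m + 2)) evenBernoulli_mul_evenBernoulli_sub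
  rw [mul_assoc, coeff_C_mul, mul_comm (X ^ 2), coeff_mul_X_pow, coeff_starSeries_even,
    mul_comm (evenBernoulli _), coeff_mul,
    Nat.sum_antidiagonal_eq_sum_range_succ (fun a b => coeff a
      (evenBernoulli (Complex.I * Real.pi) - evenBernoulli (2 * (Complex.I * Real.pi))) *
      coeff b (evenBernoulli Real.pi)),
    show (2 * m + 2).succ = 2 * (m + 1) + 1 by omega, sum_range_two_mul_add_one] at h
  simp only [map_sub, coeff_evenBernoulli] at h
  have hodd : ∀ (k : ℕ) (c : ℂ), c ^ (2 * k + 1) + (-c) ^ (2 * k + 1) = 0 := fun k c => by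
    rw [Odd.neg_pow ⟨k, rfl⟩, add_neg_cancel]
  have heven : ∀ (k : ℕ) (c : ℂ), c ^ (2 * k) + (-c) ^ (2 * k) = 2 * c ^ (2 * k) := fun k c => by
    rw [Even.neg_pow ⟨k, two_mul k⟩, ← two_mul]
  -- The odd terms vanish by parity. The index 0 term vanishes because the two cotangent series have
  -- equal constant terms, so the sum starts at degree 2, whence the shift to `2 * k + 2`.
  simp only [hodd, pow_zero, sub_self, zero_mul, zero_add] at h
  apply Complex.ofReal_injective
  apply mul_left_cancel₀ (pow_ne_zero 2 hpi)
  rw [← h]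
  push_cast
  rw [mul_sum, mul_sum]
  refine sum_congr rfl fun k hk => ?_
  have hk' : k ≤ m := by simpa [Nat.lt_succ_iff] using hk
  obtain ⟨j, rfl⟩ := Nat.exists_eq_add_of_le hk'
  rw [show 2 * (k + j) - 2 * k = 2 * j by omega, show 2 * k + 2 = 2 * (k + 1) by ring,
    heven, heven, heven, mul_pow 2, mul_pow Complex.I, pow_mul Complex.I, Complex.I_sq,
    pow_mul 2, show (2 : ℂ) ^ 2 = 4 by norm_num]
  ring

theorem theorem1 (d : ℕ) :
    (Summable (zetaStarTerm (repeatIndex [3, 1] d)) ∧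
      zetaStar (repeatIndex [3, 1] d) =
        4 * Real.pi ^ (4 * d) *
          ∑ k ∈ Finset.range (2 * d + 1),
            (-1 : ℝ) ^ k * (4 ^ (k + 1) - 1) *
              ((bernoulli (2 * k + 2) : ℝ) / ((2 * k + 2).factorial : ℝ)) *
              ((bernoulli (4 * d - 2 * k) : ℝ) / ((4 * d - 2 * k).factorial : ℝ))) ∧
    (Summable (zetaStarTerm (repeatIndex [3, 1] d ++ [2])) ∧
      zetaStar (repeatIndex [3, 1] d ++ [2]) =
        4 * Real.pi ^ (4 * d + 2) *
          ∑ k ∈ Finset.range (2 * d + 2),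
            (-1 : ℝ) ^ k * (4 ^ (k + 1) - 1) *
              ((bernoulli (2 * k + 2) : ℝ) / ((2 * k + 2).factorial : ℝ)) *
              ((bernoulli (4 * d + 2 - 2 * k) : ℝ) / ((4 * d + 2 - 2 * k).factorial : ℝ))) := by
  have heven := hasSum_zetaStarTerm_threeOneIndex (2 * d)
  have hodd := hasSum_zetaStarTerm_threeOneIndex (2 * d + 1)
  rw [ratioLimit_eq, threeOneIndex_even, show 2 * (2 * d) = 4 * d by ring] at heven
  rw [ratioLimit_eq, threeOneIndex_odd, show 2 * (2 * d + 1) = 4 * d + 2 by ring] at hodd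
  exact ⟨⟨heven.summable, heven.tsum_eq⟩, hodd.summable, hodd.tsum_eq⟩
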